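/- Let $\mathbb{O}$ be the real algebra of octonions with standard basis $e_0=1,e_1,\dots,e_7$ and Euclidean norm $|\cdot|$, let $\mathbb{S}=\{J\in\mathbb{O}: J^2=-1\}$, and for $J\in\mathbb{S}$ put $\mathbb{C}_J=\{a+bJ: a,b\in\mathbb{R}\}$. Let $V\neq 0$ be a Banach $\mathbb{O}$-bimodule, that is, a real Banach space with real-bilinear unital left and right multiplications by octonions such that, for all $p,q\in\mathbb{O}$ and $x\in V$, the associators $[a,b,c]=(ab)c-a(bc)$ satisfy $[p,q,x]=[q,x,p]=[x,p,q]=-[q,p,x]$ and $\|px\|=|p|\,\|x\|=\|xp\|$. Put $\operatorname{Re}V=\{v\in V: [p,q,v]=0,\ pv=vp \text{ for all } p,q\in\mathbb{O}\}$; then $V=\bigoplus_{i=0}^7 e_i\operatorname{Re}V$, and $\operatorname{Re}:V\to\operatorname{Re}V$ denotes the projection onto the summand $i=0$, given by $\operatorname{Re}x=\frac{5}{12}x-\frac1{12}\sum_{i=1}^7 e_ixe_i$. Let $\mathscr{B}_{\mathbb{R}}(V)$ be the algebra of bounded real linear operators on $V$ with the operator norm, and let $R_s\in\mathscr{B}_{\mathbb{R}}(V)$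 be $R_s(v)=vs$ for $s\in\mathbb{O}$. An operator $T\in\mathscr{B}_{\mathbb{R}}(V)$ is right para-linear if $\operatorname{Re}\big(T(x)p-T(xp)\big)=0$ for all $x\in V$, $p\in\mathbb{O}$; it is power-associative if it is right para-linear and $T^n$ is right para-linear for every $n\in\mathbb{N}$. For $J\in\mathbb{S}$, an operator $S\in\mathscr{B}_{\mathbb{R}}(V)$ is $\mathbb{C}_J$-extendable power associative if $S^n(vs)=S^n(v)s$ for all $n\ge1$, $v\in\operatorname{Re}V$, $s\in\mathbb{C}_J$, and $\mathbb{C}_J$-liftable power associative if $\operatorname{Re}(S^n(vs))=\operatorname{Re}(S^n(v)s)$ for all $n\ge1$, $v\in V$, $s\in\mathbb{C}_J$. Let $\rho^*_J(T)$ (resp. $\rho_{*J}(T)$) be the set of all $s\in\mathbb{C}_J$ such that $R_s-T$ is invertible in $\mathscr{B}_{\mathbb{R}}(V)$ and $(R_s-T)^{-1}$ is $\mathbb{C}_J$-extendable (resp. $\mathbb{C}_J$-liftable) power associative, and put $$\rho^*(T)=\bigcup_{J\in\mathbb{S}}\rho^*_J(T),\quad \rho_*(T)=\bigcup_{J\in\mathbb{S}}\rho_{*J}(T),\quad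 \sigma^*_J(T)=\mathbb{C}_J\setminus\rho^*_J(T),\quad \sigma_{*J}(T)=\mathbb{C}_J\setminus\rho_{*J}(T).$$ Let $T$ be power-associative. Then every $s\in\mathbb{O}$ with $|s|>\|T\|$ lies in both $\rho^*(T)$ and $\rho_*(T)$. Moreover, for every $J\in\mathbb{S}$, the slice spectra $\sigma^*_J(T)$ and $\sigma_{*J}(T)$ are nonempty compact subsets of $\mathbb{C}_J$. -/

import Mathlib

open scoped Quaternion

/-- The octonions as Cayley-Dickson pairs `a + b ℓ` of quaternions `a`, `b`, with the Euclidean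
norm of `ℝ⁸`. -/
def Octonion : Type := WithLp 2 (ℍ[ℝ] × ℍ[ℝ])

namespace Octonion

noncomputable instance : NormedAddCommGroup Octonion :=
  inferInstanceAs (NormedAddCommGroup (WithLp 2 (ℍ[ℝ] × ℍ[ℝ])))

noncomputable instance : InnerProductSpace ℝ Octonion :=
  inferInstanceAs (InnerProductSpace ℝ (WithLp 2 (ℍ[ℝ] × ℍ[ℝ])))

/-- The octonion `a + b ℓ`. -/
def mk (a b : ℍ[ℝ]) : Octonion := WithLp.toLp 2 (a, b)

/-- The first quaternionic component of an octonion. -/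
def left (x : Octonion) : ℍ[ℝ] := (WithLp.ofLp x).1

/-- The second quaternionic component of an octonion. -/
def right (x : Octonion) : ℍ[ℝ] := (WithLp.ofLp x).2

/-- Octonion multiplication: `(a + b ℓ) (c + d ℓ) = (a c - d̄ b) + (d a + b c̄) ℓ`. -/
noncomputable instance : Mul Octonion where
  mul x y := mk (x.left * y.left - star y.right * x.right)
    (y.right * x.left + x.right * star y.left)

noncomputable instance : One Octonion where
  one := mk 1 0

/-- The standard basis `e 0 = 1, e 1, …, e 7` of the octonions: `1, i, j, k, ℓ, i ℓ, j ℓ, k ℓ`. -/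
noncomputable def e (n : Fin 8) : Octonion :=
  let x : Fin 8 → ℝ := Pi.single n 1
  mk ⟨x 0, x 1, x 2, x 3⟩ ⟨x 4, x 5, x 6, x 7⟩

/-- The set `𝕊` of imaginary units of the octonions. -/
def imaginaryUnits : Set Octonion := {J | J * J = -1}

/-- The complex slice `ℂ_J = {a + b J : a, b ∈ ℝ}`. -/
def slice (J : Octonion) : Set Octonion := {s | ∃ a b : ℝ, s = a • (1 : Octonion) + b • J}

/-- The seven oriented triples of the Fano plane fix the multiplication of the basis. -/
theorem e_mul_e : e 1 * e 2 = e 3 ∧ e 1 * e 4 = e 5 ∧ e 1 * e 7 = e 6 ∧ e 2 * e 4 = e 6 ∧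
    e 2 * e 5 = e 7 ∧ e 3 * e 4 = e 7 ∧ e 3 * e 6 = e 5 := by
  have h (x y : Octonion) : x * y = mk (x.left * y.left - star y.right * x.right)
    (y.right * x.left + x.right * star y.left) := rfl
  have hl (n : Fin 8) : (e n).left.re = Pi.single (M := fun _ => ℝ) n 1 0 ∧
    (e n).left.imI = Pi.single (M := fun _ => ℝ) n 1 1 ∧
    (e n).left.imJ = Pi.single (M := fun _ => ℝ) n 1 2 ∧
    (e n).left.imK = Pi.single (M := fun _ => ℝ) n 1 3 := ⟨rfl, rfl, rfl, rfl⟩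
  have hr (n : Fin 8) : (e n).right.re = Pi.single (M := fun _ => ℝ) n 1 4 ∧
    (e n).right.imI = Pi.single (M := fun _ => ℝ) n 1 5 ∧
    (e n).right.imJ = Pi.single (M := fun _ => ℝ) n 1 6 ∧
    (e n).right.imK = Pi.single (M := fun _ => ℝ) n 1 7 := ⟨rfl, rfl, rfl, rfl⟩
  refine ⟨?_, ?_, ?_, ?_, ?_, ?_, ?_⟩ <;> rw [h] <;> refine congrArg₂ mk ?_ ?_ <;> ext <;>
    simp [hl, hr]

end Octonion

/-- An `𝕆`-bimodule: a real vector space with real-bilinear unital left multiplication `lmul p x`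
(that is `p x`) and right multiplication `rmul p x` (that is `x p`), such that
`[p,q,x] = [q,x,p] = [x,p,q] = -[q,p,x]`, where
`[p,q,x] = (pq)x - p(qx)`, `[q,x,p] = (qx)p - q(xp)` and `[x,p,q] = (xp)q - x(pq)`. -/
class OctonionBimodule (V : Type*) [AddCommGroup V] [Module ℝ V] where
  lmul : Octonion →ₗ[ℝ] V →ₗ[ℝ] V
  rmul : Octonion →ₗ[ℝ] V →ₗ[ℝ] V
  one_lmul : ∀ x : V, lmul 1 x = x
  rmul_one : ∀ x : V, rmul 1 x = x
  left_assoc_eq_middle : ∀ (p q : Octonion) (x : V),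
    lmul (p * q) x - lmul p (lmul q x) = rmul p (lmul q x) - lmul q (rmul p x)
  middle_assoc_eq_right : ∀ (p q : Octonion) (x : V),
    rmul p (lmul q x) - lmul q (rmul p x) = rmul q (rmul p x) - rmul (p * q) x
  left_assoc_alternating : ∀ (p q : Octonion) (x : V),
    lmul (p * q) x - lmul p (lmul q x) = -(lmul (q * p) x - lmul q (lmul p x))

/-- A normed `𝕆`-bimodule: `‖p x‖ = |p| ‖x‖ = ‖x p‖`. A Banach `𝕆`-bimodule is a normed
`𝕆`-bimodule that is a complete space. -/
class NormedOctonionBimodule (V : Type*) [NormedAddCommGroup V] [NormedSpace ℝ V] extends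
    OctonionBimodule V where
  norm_lmul : ∀ (p : Octonion) (x : V), ‖lmul p x‖ = ‖p‖ * ‖x‖
  norm_rmul : ∀ (p : Octonion) (x : V), ‖rmul p x‖ = ‖p‖ * ‖x‖

namespace OctonionBimodule

section Algebra

variable {V : Type*} [AddCommGroup V] [Module ℝ V] [OctonionBimodule V]

variable (V) in
/-- The real part `Re V` of a bimodule: the elements that associate and commute with all
octonions. -/
def realPart : Set V :=
  {m | (∀ p q : Octonion, lmul (p * q) m - lmul p (lmul q m) = 0) ∧
    ∀ p : Octonion, lmul p m - rmul p m = 0}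

/-- The real part operator `Re : V → Re V`, the projection onto the summand `Re V` of
`V = ⨁ i, e i (Re V)`, given by `Re x = (5/12) x - (1/12) ∑_{i=1}^7 e_i x e_i`. -/
noncomputable def re (x : V) : V :=
  (5 / 12 : ℝ) • x - (1 / 12 : ℝ) • ∑ i : Fin 7, rmul (Octonion.e i.succ)
    (lmul (Octonion.e i.succ) x)

end Algebra

section Operators

variable {V : Type*} [NormedAddCommGroup V] [NormedSpace ℝ V] [NormedOctonionBimodule V]

/-- A bounded real linear operator `T` is right para-linear if `Re (T(x) p - T(x p)) = 0`. -/
def IsParaLinear (T : V →L[ℝ] V) : Prop :=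
  ∀ (p : Octonion) (x : V), re (rmul p (T x) - T (rmul p x)) = 0

/-- A bounded right para-linear operator is power-associative if all its powers are right
para-linear. -/
def IsPowerAssociative (T : V →L[ℝ] V) : Prop :=
  IsParaLinear T ∧ ∀ n : ℕ, IsParaLinear (T ^ n)

/-- `T` is `ℂ_J`-extendable power associative: `Tⁿ(v s) = Tⁿ(v) s` for `n ≥ 1`, `v ∈ Re V`,
`s ∈ ℂ_J`. -/
def IsExtendablePowerAssociative (J : Octonion) (T : V →L[ℝ] V) : Prop :=
  ∀ n : ℕ, 1 ≤ n → ∀ v ∈ realPart V, ∀ s ∈ Octonion.slice J,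
    (T ^ n) (rmul s v) = rmul s ((T ^ n) v)

/-- `T` is `ℂ_J`-liftable power associative: `Re (Tⁿ(v s)) = Re (Tⁿ(v) s)` for `n ≥ 1`, `v ∈ V`,
`s ∈ ℂ_J`. -/
def IsLiftablePowerAssociative (J : Octonion) (T : V →L[ℝ] V) : Prop :=
  ∀ n : ℕ, 1 ≤ n → ∀ v : V, ∀ s ∈ Octonion.slice J,
    re ((T ^ n) (rmul s v)) = re (rmul s ((T ^ n) v))

variable (V) in
/-- The bounded real linear operator `R_s : v ↦ v s`. -/
noncomputable def R (s : Octonion) : V →L[ℝ] V :=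
  LinearMap.mkContinuous (rmul s) ‖s‖ fun x => (NormedOctonionBimodule.norm_rmul s x).le

/-- The pull-back slice-resolvent set `ρ*_J(T)`: the `s ∈ ℂ_J` for which `R_s - T` has a two-sided
inverse `S` among the bounded real linear operators and `S` is `ℂ_J`-extendable power
associative. -/
def pullbackSliceResolventSet (T : V →L[ℝ] V) (J : Octonion) : Set Octonion :=
  {s | s ∈ Octonion.slice J ∧ ∃ S : V →L[ℝ] V,
    (R V s - T) * S = 1 ∧ S * (R V s - T) = 1 ∧ IsExtendablePowerAssociative J S}

/-- The pull-back resolvent set `ρ*(T)`. -/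
def pullbackResolventSet (T : V →L[ℝ] V) : Set Octonion :=
  ⋃ J ∈ Octonion.imaginaryUnits, pullbackSliceResolventSet T J

/-- The pull-back slice spectrum `σ*_J(T) = ℂ_J \ ρ*_J(T)`. -/
def pullbackSliceSpectrum (T : V →L[ℝ] V) (J : Octonion) : Set Octonion :=
  Octonion.slice J \ pullbackSliceResolventSet T J

/-- The push-forward slice-resolvent set `ρ_{*J}(T)`: the `s ∈ ℂ_J` for which `R_s - T` has a
two-sided inverse `S` among the bounded real linear operators and `S` is `ℂ_J`-liftable power
associative. -/
def pushforwardSliceResolventSet (T : V →L[ℝ] V) (J : Octonion) : Set Octonion :=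
  {s | s ∈ Octonion.slice J ∧ ∃ S : V →L[ℝ] V,
    (R V s - T) * S = 1 ∧ S * (R V s - T) = 1 ∧ IsLiftablePowerAssociative J S}

/-- The push-forward resolvent set `ρ_*(T)`. -/
def pushforwardResolventSet (T : V →L[ℝ] V) : Set Octonion :=
  ⋃ J ∈ Octonion.imaginaryUnits, pushforwardSliceResolventSet T J

/-- The push-forward slice spectrum `σ_{*J}(T) = ℂ_J \ ρ_{*J}(T)`. -/
def pushforwardSliceSpectrum (T : V →L[ℝ] V) (J : Octonion) : Set Octonion :=
  Octonion.slice J \ pushforwardSliceResolventSet T J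

end Operators

end OctonionBimodule

/-! Both spectra reduce to one statement about a real Banach algebra `A` with an isometric embedding
`ρ` of `ℂ` and a fixed element `P ≠ 0`. For the pull-back case `A` is the algebra of bounded
operators, `ρ z` is right multiplication by a point of `ℂ_J` and `P` is the projection `Re`.
Extendability of `S` then says that all powers of `S` commute with `ρ` on `P`. Liftability is the
same condition in the opposite algebra.

In `A`, left multiplication by `ρ` is a complex structure for which multiplication by `T` need not
be linear. It is linear on `commutingSubmodule ρ T`, which contains `P` and is closed and stable
under `T` and `ρ`. Neumann series therefore stay compatible with `P`, so the resolvent set is open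
and contains every `z` with `‖T‖ < ‖z‖`. If it were all of `ℂ`, then `z ↦ S z * P`, with `S z` the
inverse of `ρ z - T`, would be entire and vanish at infinity. Liouville's theorem would make it
zero, forcing `P = 0`.

It remains to see that a power-associative `T` satisfies the hypothesis on `P`. The liftable case is
para-linearity of the powers. The extendable case, `IsParaLinear.map_rmul`, needs two facts: `Re`
kills associators (`reOp_mul_assocOp`), and `x = 0` as soon as `Re (x q) = 0` for all `q`
(`eq_zero_of_re_rmul_eq_zero`). Both come from Moufang-type operator identities for the maps `x ↦
e_i x e_i`, summed over the Fano lines through one point. -/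

/-! ### Resolvents in a real Banach algebra containing a copy of `ℂ` -/

section SliceResolvent

variable {A : Type*} [NormedRing A] [NormedAlgebra ℝ A]

/-- The elements on which all powers of `M` commute with the image of `ρ`. -/
def commutingSubmodule (ρ : ℂ →ₐ[ℝ] A) (M : A) : Submodule ℝ A where
  carrier := {X | ∀ (n : ℕ) (w : ℂ), M ^ n * (ρ w * X) = ρ w * (M ^ n * X)}
  add_mem' hX hY n w := by simp only [mul_add, hX n w, hY n w]
  zero_mem' n w := by simp
  smul_mem' c X hX n w := by simp only [mul_smul_comm, hX n w]

/-- The operators that preserve the submodule `W` and commute on it with the image of `ρ`. -/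
def commutingSubmonoid (ρ : ℂ →ₐ[ℝ] A) (W : Submodule ℝ A) : Submonoid A where
  carrier := {S | ∀ X ∈ W, S * X ∈ W ∧ ∀ w : ℂ, S * (ρ w * X) = ρ w * (S * X)}
  one_mem' X hX := by simpa using hX
  mul_mem' {S S'} hS hS' X hX := by
    refine ⟨by simpa [mul_assoc] using (hS _ (hS' X hX).1).1, fun w => ?_⟩
    rw [mul_assoc, (hS' X hX).2 w, (hS _ (hS' X hX).1).2 w, mul_assoc]

/-- The points `z` at which `ρ z - T` has an inverse whose powers commute with the image of `ρ`
after multiplication by `P`. -/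
def sliceResolvent (ρ : ℂ →ₐ[ℝ] A) (T P : A) : Set ℂ :=
  {z | ∃ S : A, (ρ z - T) * S = 1 ∧ S * (ρ z - T) = 1 ∧ P ∈ commutingSubmodule ρ S}

variable (ρ : ℂ →ₐ[ℝ] A)

theorem isClosed_commutingSubmodule (M : A) :
    IsClosed (commutingSubmodule ρ M : Set A) := by
  have : (commutingSubmodule ρ M : Set A) =
      ⋂ (n : ℕ) (w : ℂ), {X | M ^ n * (ρ w * X) = ρ w * (M ^ n * X)} := by
    ext X; simp [commutingSubmodule]
  rw [this]
  exact isClosed_iInter fun n => isClosed_iInter fun w =>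
    isClosed_eq (by fun_prop) (by fun_prop)

theorem map_mem_commutingSubmonoid (M : A) (z : ℂ) :
    ρ z ∈ commutingSubmonoid ρ (commutingSubmodule ρ M) := by
  intro X hX
  refine ⟨fun n w => ?_, fun w => ?_⟩
  · rw [← mul_assoc (ρ w), ← map_mul, hX n, hX n, ← mul_assoc (ρ w), ← map_mul]
  · rw [← mul_assoc, ← map_mul, mul_comm, map_mul, mul_assoc]

/-- Stability under `M` shifts the exponent from `n` to `n + 1`; this is why the submodule is
defined by all powers of `M`. -/
theorem self_mem_commutingSubmonoid (M : A) :
    M ∈ commutingSubmonoid ρ (commutingSubmodule ρ M) := by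
  intro X hX
  have h1 (w : ℂ) : M * (ρ w * X) = ρ w * (M * X) := by simpa using hX 1 w
  refine ⟨fun n w => ?_, h1⟩
  rw [← h1, ← mul_assoc, ← pow_succ, hX (n + 1) w, pow_succ, mul_assoc]

/-- The submonoid contains the powers of `S`, so an inverse assembled from its elements
automatically satisfies the condition on all powers. -/
theorem mem_commutingSubmodule_of_mem_commutingSubmonoid {W : Submodule ℝ A} {S X : A}
    (hS : S ∈ commutingSubmonoid ρ W) (hX : X ∈ W) : X ∈ commutingSubmodule ρ S :=
  fun n w => (pow_mem hS n X hX).2 w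

variable [CompleteSpace A]

/-- The Neumann series stays in the commuting submonoid. -/
theorem exists_inverse_mem_commutingSubmonoid (M : A) (a : ℂ) (h : ‖ρ a * M‖ < 1) :
    ∃ K ∈ commutingSubmonoid ρ (commutingSubmodule ρ M),
      (1 - ρ a * M) * K = 1 ∧ K * (1 - ρ a * M) = 1 := by
  set t := ρ a * M with ht
  have htm : t ∈ commutingSubmonoid ρ (commutingSubmodule ρ M) :=
    mul_mem (map_mem_commutingSubmonoid ρ M a) (self_mem_commutingSubmonoid ρ M)
  have hs : Summable fun n : ℕ => t ^ n := summable_geometric_of_norm_lt_one h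
  have h1 : (1 - t) * ∑' n : ℕ, t ^ n = 1 := mul_neg_geom_series t h
  have h2 : (∑' n : ℕ, t ^ n) * (1 - t) = 1 := geom_series_mul_neg t h
  have hmem : ∀ X ∈ commutingSubmodule ρ M, (∑' n : ℕ, t ^ n) * X ∈ commutingSubmodule ρ M := by
    intro X hX
    rw [← hs.tsum_mul_right]
    refine (isClosed_commutingSubmodule ρ M).mem_of_tendsto
      (hs.mul_right X).hasSum (Filter.Eventually.of_forall fun s => ?_)
    exact Submodule.sum_mem _ fun n _ => (pow_mem htm n X hX).1
  refine ⟨∑' n : ℕ, t ^ n, fun X hX => ⟨hmem X hX, fun w => ?_⟩, h1, h2⟩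
  -- Commutation is checked after applying the injective map `1 - t`, which commutes with `ρ w` on
  -- the submodule.
  have hc : (1 - t) * (ρ w * ((∑' n : ℕ, t ^ n) * X)) = ρ w * X := by
    rw [sub_mul, one_mul, (htm _ (hmem X hX)).2 w, ← mul_sub]
    congr 1
    rw [← mul_assoc t, ← sub_mul]
    nth_rewrite 1 [← one_mul (∑' n : ℕ, t ^ n)]
    rw [← sub_mul, h1, one_mul]
  rw [← hc, ← mul_assoc, h2, one_mul]

theorem mem_sliceResolvent_of_norm_lt (hρ : ∀ z, ‖ρ z‖ = ‖z‖) {T P : A}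
    (hT : P ∈ commutingSubmodule ρ T) {z : ℂ} (hz : ‖T‖ < ‖z‖) : z ∈ sliceResolvent ρ T P := by
  have hz0 : z ≠ 0 := norm_pos_iff.1 ((norm_nonneg T).trans_lt hz)
  have hlt : ‖ρ z⁻¹ * T‖ < 1 := by
    refine (norm_mul_le _ _).trans_lt ?_
    rw [hρ, norm_inv, inv_mul_lt_iff₀ (norm_pos_iff.2 hz0), mul_one]
    exact hz
  obtain ⟨K, hK, h1, h2⟩ := exists_inverse_mem_commutingSubmonoid ρ T z⁻¹ hlt
  have hzz : ρ z * ρ z⁻¹ = 1 := by rw [← map_mul, mul_inv_cancel₀ hz0, map_one]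
  have hzz' : ρ z⁻¹ * ρ z = 1 := by rw [← map_mul, inv_mul_cancel₀ hz0, map_one]
  have hf : ρ z - T = ρ z * (1 - ρ z⁻¹ * T) := by
    rw [mul_sub, ← mul_assoc, hzz, one_mul, mul_one]
  refine ⟨K * ρ z⁻¹, ?_, ?_, ?_⟩
  · rw [hf, mul_assoc, ← mul_assoc _ K, h1, one_mul, hzz]
  · rw [hf, mul_assoc, ← mul_assoc _ (ρ z), hzz', one_mul, h2]
  · exact mem_commutingSubmodule_of_mem_commutingSubmonoid ρ
      (mul_mem hK (map_mem_commutingSubmonoid ρ T _)) hT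

/-- The factorization is `ρ w - T = (1 - ρ (z - w) * S) * (ρ z - T)`. The Neumann series is taken
relative to `S`, so that the new inverse preserves the commuting submodule of `S`, which contains
`P`. -/
theorem isOpen_sliceResolvent (hρ : ∀ z, ‖ρ z‖ = ‖z‖) (T P : A) :
    IsOpen (sliceResolvent ρ T P) := by
  rw [Metric.isOpen_iff]
  rintro z ⟨S, hS1, hS2, hS⟩
  -- Adding `1` keeps the radius positive even when `‖S‖ = 0`.
  refine ⟨(‖S‖ + 1)⁻¹, by positivity, fun w hw => ?_⟩
  rw [mem_ball_iff_norm] at hw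
  have hlt : ‖ρ (z - w) * S‖ < 1 := by
    refine (norm_mul_le _ _).trans_lt ?_
    rw [hρ, norm_sub_rev]
    calc ‖w - z‖ * ‖S‖ ≤ ‖w - z‖ * (‖S‖ + 1) := by gcongr; linarith
      _ < (‖S‖ + 1)⁻¹ * (‖S‖ + 1) := by gcongr
      _ = 1 := inv_mul_cancel₀ (by positivity)
  obtain ⟨K, hK, h1, h2⟩ := exists_inverse_mem_commutingSubmonoid ρ S (z - w) hlt
  have hf : ρ w - T = (1 - ρ (z - w) * S) * (ρ z - T) := by
    rw [sub_mul, mul_assoc, hS2, mul_one, map_sub, one_mul]; abel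
  refine ⟨S * K, ?_, ?_, ?_⟩
  · rw [hf, mul_assoc, ← mul_assoc _ S, hS1, one_mul, h1]
  · rw [hf, mul_assoc, ← mul_assoc K, h2, one_mul, hS2]
  · exact mem_commutingSubmodule_of_mem_commutingSubmonoid ρ
      (mul_mem (self_mem_commutingSubmonoid ρ S) hK) hS

theorem isCompact_compl_sliceResolvent (hρ : ∀ z, ‖ρ z‖ = ‖z‖) {T P : A}
    (hT : P ∈ commutingSubmodule ρ T) : IsCompact (sliceResolvent ρ T P)ᶜ := by
  refine Metric.isCompact_of_isClosed_isBounded (isOpen_sliceResolvent ρ hρ T P).isClosed_compl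
    (Metric.isBounded_closedBall (x := (0 : ℂ)) (r := ‖T‖) |>.subset fun z hz => ?_)
  rw [mem_closedBall_zero_iff]
  by_contra! h
  exact hz (mem_sliceResolvent_of_norm_lt ρ hρ hT h)

theorem sliceResolvent_ne_univ (hρ : ∀ z, ‖ρ z‖ = ‖z‖) {T P : A} (hP : P ≠ 0) :
    sliceResolvent ρ T P ≠ Set.univ := by
  intro huniv
  have hall (z : ℂ) : ∃ S : A, (ρ z - T) * S = 1 ∧ S * (ρ z - T) = 1 ∧
      P ∈ commutingSubmodule ρ S := by
    have : z ∈ sliceResolvent ρ T P := huniv ▸ Set.mem_univ z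
    exact this
  choose S h1 h2 h3 using hall
  have hρc : Continuous ρ := (AddMonoidHomClass.isometry_of_norm ρ hρ).continuous
  have hSinv (z : ℂ) : S z = Ring.inverse (ρ z - T) :=
    (Ring.inverse_unit (⟨ρ z - T, S z, h1 z, h2 z⟩ : Aˣ)).symm
  have hScont : Continuous S := by
    rw [continuous_iff_continuousAt]
    intro z
    have := (NormedRing.inverse_continuousAt (⟨ρ z - T, S z, h1 z, h2 z⟩ : Aˣ)).comp
      (f := fun z => ρ z - T) (x := z) (hρc.sub continuous_const).continuousAt
    rw [funext hSinv]
    exact this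
  have hdiff (w z : ℂ) : S w - S z = -(S w * ρ (w - z) * S z) := by
    have : ρ (w - z) = (ρ w - T) - (ρ z - T) := by rw [map_sub]; abel
    rw [this, mul_sub, sub_mul, h2, mul_assoc, h1, one_mul, mul_one, neg_sub]
  -- Scalars act by left multiplication through `ρ`, which does not make left multiplication by `S
  -- z` complex linear. Hence differentiability is claimed for `S z * P` and not for `S z`.
  let _ : Module ℂ A := Module.compHom A ρ.toRingHom
  have smul_eq (z : ℂ) (X : A) : z • X = ρ z * X := rfl
  let _ : NormedSpace ℂ A := ⟨fun z X => by
    rw [smul_eq, ← hρ]; exact norm_mul_le _ _⟩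
  have hder : Differentiable ℂ fun z => S z * P := by
    intro z
    refine HasDerivAt.differentiableAt (f' := -(S z * (S z * P))) ?_
    rw [hasDerivAt_iff_isLittleO]
    have key (w : ℂ) : S w * P - S z * P - (w - z) • (-(S z * (S z * P))) =
        (S z - S w) * (ρ (w - z) * (S z * P)) := by
      -- Exponents `2` and `1` together give `S z * ρ (w - z) * S z * P = ρ (w - z) * S z * S z *
      -- P`, which makes the linear term of the resolvent identity complex linear.
      have h := h3 z 2 (w - z)
      have h' := h3 z 1 (w - z)
      rw [pow_one] at h'
      rw [sq, mul_assoc, mul_assoc, h'] at h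
      rw [← sub_mul, hdiff, smul_eq, sub_mul, mul_neg, h]
      noncomm_ring
    simp only [key]
    rw [Asymptotics.isLittleO_iff]
    intro c hc
    have hev : ∀ᶠ w in nhds z, ‖(S z - S w)‖ * ‖S z * P‖ < c := by
      have hcont : Continuous fun w => ‖(S z - S w)‖ * ‖S z * P‖ := by fun_prop
      exact hcont.continuousAt.eventually_lt_const (by simpa using hc)
    filter_upwards [hev] with w hw
    calc ‖(S z - S w) * (ρ (w - z) * (S z * P))‖
        ≤ ‖S z - S w‖ * (‖ρ (w - z)‖ * ‖S z * P‖) :=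
          (norm_mul_le _ _).trans (by gcongr; exact norm_mul_le _ _)
      _ = (‖S z - S w‖ * ‖S z * P‖) * ‖w - z‖ := by rw [hρ]; ring
      _ ≤ c * ‖w - z‖ := by gcongr
  have hlim : Filter.Tendsto (fun z => S z * P) (Filter.cocompact ℂ) (nhds 0) := by
    rw [tendsto_zero_iff_norm_tendsto_zero]
    have hn : Filter.Tendsto (fun z : ℂ => ‖z‖ - ‖T‖) (Filter.cocompact ℂ) Filter.atTop :=
      Filter.tendsto_atTop_add_const_right _ _ (tendsto_norm_cocompact_atTop)
    have hb := (hn.inv_tendsto_atTop).mul_const ‖P‖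
    rw [zero_mul] at hb
    refine squeeze_zero' (Filter.Eventually.of_forall fun z => norm_nonneg _) ?_ hb
    filter_upwards [hn.eventually_gt_atTop 0] with z hz
    -- Taking norms here bounds `‖S z * P‖` by `‖P‖ / (‖z‖ - ‖T‖)`.
    have hPeq : z • (S z * P) = P + T * (S z * P) := by
      have := h1 z
      rw [smul_eq, ← sub_eq_iff_eq_add, ← sub_mul, ← mul_assoc, this, one_mul]
    have hle : ‖z‖ * ‖S z * P‖ ≤ ‖P‖ + ‖T‖ * ‖S z * P‖ := by
      rw [← norm_smul, hPeq]
      exact (norm_add_le _ _).trans (by gcongr; exact norm_mul_le _ _)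
    rw [Pi.inv_apply, inv_mul_eq_div, le_div_iff₀ hz]
    linarith
  have hzero := hder.apply_eq_of_tendsto_cocompact 0 hlim
  apply hP
  rw [← one_mul P, ← h1 0, mul_assoc, hzero, mul_zero]

end SliceResolvent

/-! ### Alternativity of the octonions, by coordinates -/

namespace Octonion

theorem mul_def (x y : Octonion) : x * y = mk (x.left * y.left - star y.right * x.right)
    (y.right * x.left + x.right * star y.left) := rfl

theorem left_mk (a b : ℍ[ℝ]) : (mk a b).left = a := rfl
theorem right_mk (a b : ℍ[ℝ]) : (mk a b).right = b := rfl
theorem left_one : (1 : Octonion).left = 1 := rfl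
theorem right_one : (1 : Octonion).right = 0 := rfl
theorem left_neg (x : Octonion) : (-x).left = -x.left := rfl
theorem right_neg (x : Octonion) : (-x).right = -x.right := rfl
theorem left_add (x y : Octonion) : (x + y).left = x.left + y.left := rfl
theorem right_add (x y : Octonion) : (x + y).right = x.right + y.right := rfl
theorem left_smul (c : ℝ) (x : Octonion) : (c • x).left = c • x.left := rfl
theorem right_smul (c : ℝ) (x : Octonion) : (c • x).right = c • x.right := rfl

theorem ext_components {x y : Octonion} (h : x.left = y.left) (h' : x.right = y.right) : x = y :=
  congrArg (WithLp.toLp 2) (Prod.ext h h')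

theorem exists_components (x : Octonion) :
    ∃ a b c d a' b' c' d' : ℝ, x = mk ⟨a, b, c, d⟩ ⟨a', b', c', d'⟩ :=
  ⟨_, _, _, _, _, _, _, _, rfl⟩

set_option maxHeartbeats 1000000 in
theorem mul_mul_self (p q : Octonion) : q * p * p = q * (p * p) := by
  obtain ⟨p0, p1, p2, p3, p4, p5, p6, p7, rfl⟩ := p.exists_components
  obtain ⟨q0, q1, q2, q3, q4, q5, q6, q7, rfl⟩ := q.exists_components
  refine ext_components ?_ ?_ <;> ext <;> simp [mul_def, left_mk, right_mk] <;> ring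

set_option maxHeartbeats 1000000 in
theorem self_mul_self_mul (p q : Octonion) : p * p * q = p * (p * q) := by
  obtain ⟨p0, p1, p2, p3, p4, p5, p6, p7, rfl⟩ := p.exists_components
  obtain ⟨q0, q1, q2, q3, q4, q5, q6, q7, rfl⟩ := q.exists_components
  refine ext_components ?_ ?_ <;> ext <;> simp [mul_def, left_mk, right_mk] <;> ring

set_option maxHeartbeats 1000000 in
theorem mul_mul_self_left (p q : Octonion) : p * q * p = p * (q * p) := by
  obtain ⟨p0, p1, p2, p3, p4, p5, p6, p7, rfl⟩ := p.exists_components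
  obtain ⟨q0, q1, q2, q3, q4, q5, q6, q7, rfl⟩ := q.exists_components
  refine ext_components ?_ ?_ <;> ext <;> simp [mul_def, left_mk, right_mk] <;> ring

end Octonion

/-! ### Associator and Moufang identities as operator identities -/

namespace OctonionBimodule

section Associators

variable {V : Type*} [AddCommGroup V] [Module ℝ V] [OctonionBimodule V]

variable (V) in
/-- Left multiplication as an element of the ring of endomorphisms. -/
noncomputable def lop : Octonion →ₗ[ℝ] Module.End ℝ V := lmul

variable (V) in
/-- Right multiplication as an element of the ring of endomorphisms. -/
noncomputable def rop : Octonion →ₗ[ℝ] Module.End ℝ V := rmul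

variable (V) in
/-- The associator `x ↦ [p,q,x]`. -/
noncomputable def assocOp (p q : Octonion) : Module.End ℝ V := lop V (p * q) - lop V p * lop V q

variable (V) in
/-- The operator `x ↦ (p x) p`. -/
noncomputable def conjOp (p : Octonion) : Module.End ℝ V := rop V p * lop V p

theorem assocOp_left (p q : Octonion) :
    assocOp V p q = lop V (p * q) - lop V p * lop V q := rfl

theorem assocOp_middle (p q : Octonion) :
    assocOp V p q = rop V p * lop V q - lop V q * rop V p :=
  LinearMap.ext (left_assoc_eq_middle p q)

theorem assocOp_right (p q : Octonion) :
    assocOp V p q = rop V q * rop V p - rop V (p * q) :=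
  LinearMap.ext fun x => (left_assoc_eq_middle p q x).trans (middle_assoc_eq_right p q x)

theorem assocOp_swap (p q : Octonion) : assocOp V p q = -assocOp V q p :=
  LinearMap.ext (left_assoc_alternating p q)

theorem assocOp_self (p : Octonion) : assocOp V p p = 0 := by
  linear_combination (norm := module) (1 / 2 : ℝ) • assocOp_swap (V := V) p p

/-- A skew-symmetry of the Kleinfeld function of an alternative algebra. -/
theorem kleinfeld (x y z : Octonion) :
    assocOp V (x * y) z - lop V y * assocOp V x z - rop V x * assocOp V y z =
      lop V (x * y * z) - lop V (x * (y * z)) + lop V x * assocOp V y z -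
        assocOp V y z * rop V x := by
  -- The five-term associator identity for `(x, y, z, v)`; `h2` is the same identity for `(y, z, v,
  -- x)`, rewritten by cyclic symmetry. The terms in `x, y z` and in `x, y` cancel in the sum.
  have h1 : assocOp V (x * y) z - assocOp V x (y * z) + assocOp V x y * lop V z
      - lop V x * assocOp V y z - (lop V (x * y * z) - lop V (x * (y * z))) = 0 := by
    simp only [assocOp_left]; noncomm_ring
  have h2 : assocOp V x (y * z) - assocOp V x y * lop V z + assocOp V y z * rop V x
      - lop V y * assocOp V x z - rop V x * assocOp V y z = 0 := by
    rw [assocOp_middle x, assocOp_middle x, assocOp_middle x, assocOp_left]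
    noncomm_ring
  linear_combination (norm := noncomm_ring) h1 + h2

theorem rop_mul_rop (p q : Octonion) :
    rop V q * rop V p = rop V (p * q) + assocOp V p q := by
  rw [assocOp_right]; abel

theorem lop_mul_lop (p q : Octonion) :
    lop V p * lop V q = lop V (p * q) - assocOp V p q := by
  rw [assocOp_left]; abel

theorem rop_mul_lop (p q : Octonion) :
    rop V p * lop V q = lop V q * rop V p + assocOp V p q := by
  rw [assocOp_middle]; abel

theorem rop_mul_lop_self (p : Octonion) : rop V p * lop V p = lop V p * rop V p := by
  rw [rop_mul_lop, assocOp_self, add_zero]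

theorem assocOp_mul_right_self (p q : Octonion) :
    assocOp V (q * p) p = lop V p * assocOp V q p := by
  have h := kleinfeld (V := V) q p p
  rw [assocOp_self, Octonion.mul_mul_self] at h
  linear_combination (norm := noncomm_ring) h

theorem assocOp_mul_right_self' (p q : Octonion) :
    assocOp V (q * p) p = assocOp V q p * rop V p := by
  have h := kleinfeld (V := V) p p q
  have h1 : assocOp V (q * p) p = assocOp V q (p * p) - rop V p * assocOp V q p := by
    rw [assocOp_right, assocOp_right, assocOp_right, Octonion.mul_mul_self, mul_sub,
      ← mul_assoc, rop_mul_rop p p, assocOp_self]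
    noncomm_ring
  rw [Octonion.self_mul_self_mul, assocOp_swap p q, assocOp_swap (p * p) q] at h
  have h2 := assocOp_mul_right_self (V := V) p q
  linear_combination (norm := noncomm_ring) h - h1 + 2 * h2

theorem assocOp_self_mul (p q : Octonion) :
    assocOp V p (p * q) = rop V p * assocOp V p q := by
  have h := kleinfeld (V := V) p q p
  have h2 := assocOp_mul_right_self (V := V) p q
  rw [assocOp_mul_right_self'] at h2
  rw [assocOp_self, Octonion.mul_mul_self_left, assocOp_swap (p * q), assocOp_swap q] at h
  rw [assocOp_swap q] at h2
  linear_combination (norm := noncomm_ring) -h + h2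

theorem assocOp_self_mul' (p q : Octonion) :
    assocOp V p (p * q) = assocOp V p q * lop V p := by
  have h2 := assocOp_mul_right_self (V := V) p q
  have h3 : lop V (p * q * p) = lop V (p * (q * p)) := by rw [Octonion.mul_mul_self_left]
  rw [assocOp_swap, assocOp_left p q]
  rw [assocOp_swap (q * p)] at h2
  simp only [assocOp_left] at h2 ⊢
  linear_combination (norm := noncomm_ring) h2 - h3

/-- A Moufang identity. This and the next three move `conjOp` past a one-sided multiplication,
leaving a product of one left and one right multiplication. -/
theorem lop_mul_conjOp (p q : Octonion) :
    lop V q * conjOp V p = rop V p * lop V (q * p) := by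
  rw [rop_mul_lop, assocOp_swap, assocOp_mul_right_self', conjOp, rop_mul_lop_self, assocOp_left]
  noncomm_ring

theorem conjOp_mul_lop (p q : Octonion) :
    conjOp V p * lop V q = lop V (p * q) * rop V p := by
  rw [conjOp, mul_assoc, lop_mul_lop, mul_sub, rop_mul_lop, assocOp_self_mul]
  noncomm_ring

theorem rop_mul_conjOp (p q : Octonion) :
    rop V q * conjOp V p = lop V p * rop V (p * q) := by
  have h := rop_mul_lop (V := V) (p * q) p
  rw [assocOp_swap, assocOp_self_mul', assocOp_right] at h
  rw [conjOp]
  linear_combination (norm := noncomm_ring) h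

theorem conjOp_mul_rop (p q : Octonion) :
    conjOp V p * rop V q = rop V (q * p) * lop V p := by
  rw [conjOp, rop_mul_lop_self, mul_assoc, rop_mul_rop, rop_mul_lop, mul_add,
    assocOp_mul_right_self]

/-! ### One Fano line: conjugations by two units against the third -/

/-- `p`, `q`, `u = q p` are imaginary units generating a quaternion subalgebra. -/
structure IsQuaternionic (p q u : Octonion) : Prop where
  pp : p * p = -1
  qq : q * q = -1
  uu : u * u = -1
  qp : q * p = u
  pq : p * q = -u
  pu : p * u = q
  up : u * p = -q
  qu : q * u = -p
  uq : u * q = p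

theorem lop_one : lop V 1 = 1 := LinearMap.ext one_lmul

theorem rop_one : rop V 1 = 1 := LinearMap.ext rmul_one

theorem lop_mul_self {p : Octonion} (hp : p * p = -1) : lop V p * lop V p = -1 := by
  rw [lop_mul_lop, assocOp_self, hp, map_neg, lop_one, sub_zero]

theorem rop_mul_self {p : Octonion} (hp : p * p = -1) : rop V p * rop V p = -1 := by
  rw [rop_mul_rop, assocOp_self, hp, map_neg, rop_one, add_zero]

namespace IsQuaternionic

variable {p q u : Octonion} (h : IsQuaternionic p q u)
include h

/-- The Moufang identities turn the four products into mixed left and right products, which regroup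
as `assocOp V q p - assocOp V p q`. -/
theorem commutator_mul_conjOp :
    (lop V u - rop V u) * (conjOp V p + conjOp V q) = 2 * assocOp V q p := by
  rw [sub_mul, mul_add, mul_add, lop_mul_conjOp, lop_mul_conjOp, rop_mul_conjOp, rop_mul_conjOp,
    h.up, h.uq, h.pu, h.qu, map_neg, map_neg]
  have h1 := assocOp_middle (V := V) q p
  have h2 := assocOp_middle (V := V) p q
  rw [assocOp_swap] at h2
  linear_combination (norm := noncomm_ring) -h1 + h2

theorem conjOp_mul_commutator :
    (conjOp V p + conjOp V q) * (lop V u - rop V u) = 2 * assocOp V q p := by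
  rw [mul_sub, add_mul, add_mul, conjOp_mul_lop, conjOp_mul_lop, conjOp_mul_rop, conjOp_mul_rop,
    h.up, h.uq, h.pu, h.qu, map_neg, map_neg]
  have h1 := assocOp_middle (V := V) q p
  have h2 := assocOp_middle (V := V) p q
  rw [assocOp_swap] at h2
  linear_combination (norm := noncomm_ring) -h1 + h2

theorem rop_conjOp_rop :
    rop V u * (conjOp V p + conjOp V q) * rop V u =
      conjOp V p + conjOp V q + 2 * lop V u * assocOp V q p := by
  have e1 : rop V u * rop V q = -rop V p + assocOp V q u := by
    rw [rop_mul_rop, h.qu, map_neg]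
  have e2 : rop V u * rop V p = rop V q + assocOp V p u := by
    rw [rop_mul_rop, h.pu]
  have e3 : assocOp V q u = -lop V p - lop V q * lop V u := by
    rw [assocOp_left, h.qu, map_neg]
  have e4 : assocOp V p u = lop V q - lop V p * lop V u := by
    rw [assocOp_left, h.pu]
  have e5 : lop V q * lop V p = lop V u - assocOp V q p := by rw [lop_mul_lop, h.qp]
  have e6 : lop V p * lop V q = -lop V u + assocOp V q p := by
    rw [lop_mul_lop, h.pq, map_neg, assocOp_swap p q]; abel
  have e7 : lop V q * lop V u = -(lop V u * lop V q) := by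
    rw [lop_mul_lop, lop_mul_lop, h.qu, h.uq, map_neg, assocOp_swap u]; abel
  have e8 : lop V p * lop V u = -(lop V u * lop V p) := by
    rw [lop_mul_lop, lop_mul_lop, h.pu, h.up, map_neg, assocOp_swap u]; abel
  have e9 := lop_mul_self (V := V) h.pp
  have e10 := lop_mul_self (V := V) h.qq
  have e11 : lop V u * lop V u = -1 := lop_mul_self h.uu
  rw [mul_assoc, add_mul, conjOp_mul_rop, conjOp_mul_rop, h.up, h.uq, mul_add, map_neg,
    ← mul_assoc, ← mul_assoc, mul_neg, e1, e2, e3, e4, e7, e8, conjOp, conjOp]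
  have f1 := congrArg (lop V u * ·) e5
  have f2 := congrArg (lop V u * ·) e6
  simp only [mul_add, mul_sub, mul_neg, e11] at f1 f2
  linear_combination (norm := noncomm_ring) f2 - f1 + e9 + e10

end IsQuaternionic

end Associators


/-! ### The three Fano lines through a point -/

section Triples

variable {V : Type*} [AddCommGroup V] [Module ℝ V] [OctonionBimodule V]

/-- `x`, `y`, `z` generate the octonions and `u = (x y) z`. -/
structure IsOctonionic (x y z u : Octonion) : Prop where
  hx : IsQuaternionic x (y * z) u
  hy : IsQuaternionic y (z * x) u
  hz : IsQuaternionic z (x * y) u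

namespace IsOctonionic

variable {x y z u : Octonion} (h : IsOctonionic x y z u)
include h

/-- The Kleinfeld identity is summed over cyclic permutations of `x, y, z`; expanding the
associators in their right-hand form makes everything else collapse to left and right multiplication
by `u`. -/
theorem sum_assocOp :
    assocOp V (y * z) x + assocOp V (z * x) y + assocOp V (x * y) z =
      2 * (lop V u - rop V u) := by
  have k1 := kleinfeld (V := V) x y z
  have k2 := kleinfeld (V := V) y z x
  have k3 := kleinfeld (V := V) z x y
  rw [h.hz.qp, h.hx.pq, map_neg, assocOp_swap x z] at k1
  rw [h.hx.qp, h.hy.pq, map_neg, assocOp_swap y x] at k2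
  rw [h.hy.qp, h.hz.pq, map_neg, assocOp_swap z y] at k3
  have r1 := rop_mul_rop (V := V) (y * z) x
  have r2 := rop_mul_rop (V := V) (z * x) y
  have r3 := rop_mul_rop (V := V) (x * y) z
  have s1 := rop_mul_rop (V := V) x (y * z)
  have s2 := rop_mul_rop (V := V) y (z * x)
  have s3 := rop_mul_rop (V := V) z (x * y)
  rw [h.hx.qp] at r1
  rw [h.hy.qp] at r2
  rw [h.hz.qp] at r3
  rw [h.hx.pq, map_neg, assocOp_swap] at s1
  rw [h.hy.pq, map_neg, assocOp_swap] at s2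
  rw [h.hz.pq, map_neg, assocOp_swap] at s3
  have d1 := assocOp_right (V := V) y z
  have d2 := assocOp_right (V := V) z x
  have d3 := assocOp_right (V := V) x y
  have e1 := congrArg (rop V x * ·) d1
  have e2 := congrArg (rop V y * ·) d2
  have e3 := congrArg (rop V z * ·) d3
  have f1 := congrArg (· * rop V x) d1
  have f2 := congrArg (· * rop V y) d2
  have f3 := congrArg (· * rop V z) d3
  simp only [mul_sub, sub_mul] at e1 e2 e3 f1 f2 f3
  -- The summation produces three times the desired identity, and the factor is cancelled over `ℝ`.
  have key : (3 : ℝ) • (assocOp V (y * z) x + assocOp V (z * x) y + assocOp V (x * y) z) =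
      (3 : ℝ) • (2 * (lop V u - rop V u)) := by
    have : (3 : ℕ) • (assocOp V (y * z) x + assocOp V (z * x) y + assocOp V (x * y) z) =
        (3 : ℕ) • (2 * (lop V u - rop V u)) := by
      linear_combination (norm := noncomm_ring) k1 + k2 + k3 + e1 + e2 + e3 - f1 - f2 - f3
        - r1 - r2 - r3 + s1 + s2 + s3
    simpa only [← Nat.cast_smul_eq_nsmul ℝ, Nat.cast_ofNat] using this
  exact smul_right_injective _ (three_ne_zero (α := ℝ)) key

-- The eigenvalue is `5 = 1 + 2 * 2`: `conjOp V u` contributes `1`, and the three lines contribute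
-- twice the sum in `sum_assocOp`. It is the origin of the `5 / 12` in `Re`.
variable (V) in
theorem lop_sub_rop_mul_sum : (lop V u - rop V u) *
    (conjOp V u + (conjOp V x + conjOp V (y * z)) + (conjOp V y + conjOp V (z * x)) +
      (conjOp V z + conjOp V (x * y))) = 5 * (lop V u - rop V u) := by
  have h1 : (lop V u - rop V u) * conjOp V u = lop V u - rop V u := by
    have hl := lop_mul_self (V := V) h.hx.uu
    have hr := rop_mul_self (V := V) h.hx.uu
    rw [sub_mul, conjOp, ← mul_assoc, ← mul_assoc, hr, ← rop_mul_lop_self, mul_assoc, hl]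
    noncomm_ring
  rw [mul_add, mul_add, mul_add, h1, h.hx.commutator_mul_conjOp, h.hy.commutator_mul_conjOp,
    h.hz.commutator_mul_conjOp]
  linear_combination (norm := noncomm_ring) 2 * h.sum_assocOp (V := V)

variable (V) in
theorem sum_mul_lop_sub_rop :
    (conjOp V u + (conjOp V x + conjOp V (y * z)) + (conjOp V y + conjOp V (z * x)) +
      (conjOp V z + conjOp V (x * y))) * (lop V u - rop V u) = 5 * (lop V u - rop V u) := by
  have h1 : conjOp V u * (lop V u - rop V u) = lop V u - rop V u := by
    have hl := lop_mul_self (V := V) h.hx.uu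
    have hr := rop_mul_self (V := V) h.hx.uu
    rw [mul_sub, conjOp, mul_assoc, hl, rop_mul_lop_self, mul_assoc, hr]
    noncomm_ring
  rw [add_mul, add_mul, add_mul, h1, h.hx.conjOp_mul_commutator, h.hy.conjOp_mul_commutator,
    h.hz.conjOp_mul_commutator]
  linear_combination (norm := noncomm_ring) 2 * h.sum_assocOp (V := V)

-- The three lines reproduce themselves plus `2 * lop V u` times the sum in `sum_assocOp`, that is
-- `-4 - 4 * conjOp V u`; the term of `u` changes sign, which accounts for the remaining `-2 *
-- conjOp V u`.
variable (V) in
theorem rop_mul_sum_mul_rop : rop V u *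
    (conjOp V u + (conjOp V x + conjOp V (y * z)) + (conjOp V y + conjOp V (z * x)) +
      (conjOp V z + conjOp V (x * y))) * rop V u =
    (conjOp V u + (conjOp V x + conjOp V (y * z)) + (conjOp V y + conjOp V (z * x)) +
      (conjOp V z + conjOp V (x * y))) - 6 * conjOp V u - 4 • 1 := by
  have hl := lop_mul_self (V := V) h.hx.uu
  have hr := rop_mul_self (V := V) h.hx.uu
  have h1 : rop V u * conjOp V u * rop V u = -conjOp V u := by
    rw [conjOp, ← mul_assoc, hr, neg_one_mul, neg_mul, rop_mul_lop_self]
  have h2 := congrArg (2 * lop V u * ·) (h.sum_assocOp (V := V))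
  have hx := h.hx.rop_conjOp_rop (V := V)
  have hy := h.hy.rop_conjOp_rop (V := V)
  have hz := h.hz.rop_conjOp_rop (V := V)
  simp only [mul_add] at h2
  have h3 : conjOp V u = lop V u * rop V u := rop_mul_lop_self u
  linear_combination (norm := noncomm_ring) h1 + hx + hy + hz + h2 + 4 * hl + 4 * h3

end IsOctonionic

end Triples

end OctonionBimodule

/-! ### The signed multiplication table and the Fano plane -/

namespace Octonion

/-- The index and the sign of the product of two basis octonions. -/
def signedMul : Fin 8 → Fin 8 → Bool × Fin 8 := fun i j =>
  (![![false, false, false, false, false, false, false, false],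
    ![false, true, false, true, false, true, true, false],
    ![false, true, true, false, false, false, true, true],
    ![false, false, true, true, false, true, false, true],
    ![false, true, true, true, true, false, false, false],
    ![false, false, true, false, true, true, true, false],
    ![false, false, false, true, true, false, true, true],
    ![false, true, false, false, true, true, false, true]] i j,
  ![![0, 1, 2, 3, 4, 5, 6, 7],
    ![1, 0, 3, 2, 5, 4, 7, 6],
    ![2, 3, 0, 1, 6, 7, 4, 5],
    ![3, 2, 1, 0, 7, 6, 5, 4],
    ![4, 5, 6, 7, 0, 1, 2, 3],
    ![5, 4, 7, 6, 1, 0, 3, 2],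
    ![6, 7, 4, 5, 2, 3, 0, 1],
    ![7, 6, 5, 4, 3, 2, 1, 0]] i j)

/-- The basis octonion of given index and sign. -/
noncomputable def signedE (p : Bool × Fin 8) : Octonion := if p.1 then -e p.2 else e p.2

theorem left_e_re (n : Fin 8) : (e n).left.re = if n = 0 then 1 else 0 := by
  simp [e, left, mk, Pi.single_apply, eq_comm]

theorem left_e_imI (n : Fin 8) : (e n).left.imI = if n = 1 then 1 else 0 := by
  simp [e, left, mk, Pi.single_apply, eq_comm]

theorem left_e_imJ (n : Fin 8) : (e n).left.imJ = if n = 2 then 1 else 0 := by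
  simp [e, left, mk, Pi.single_apply, eq_comm]

theorem left_e_imK (n : Fin 8) : (e n).left.imK = if n = 3 then 1 else 0 := by
  simp [e, left, mk, Pi.single_apply, eq_comm]

theorem right_e_re (n : Fin 8) : (e n).right.re = if n = 4 then 1 else 0 := by
  simp [e, right, mk, Pi.single_apply, eq_comm]

theorem right_e_imI (n : Fin 8) : (e n).right.imI = if n = 5 then 1 else 0 := by
  simp [e, right, mk, Pi.single_apply, eq_comm]

theorem right_e_imJ (n : Fin 8) : (e n).right.imJ = if n = 6 then 1 else 0 := by
  simp [e, right, mk, Pi.single_apply, eq_comm]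

theorem right_e_imK (n : Fin 8) : (e n).right.imK = if n = 7 then 1 else 0 := by
  simp [e, right, mk, Pi.single_apply, eq_comm]

theorem e_mul (i j : Fin 8) : e i * e j = signedE (signedMul i j) := by
  have h (x : Bool × Fin 8) : signedE x = (if x.1 then -1 else 1 : ℝ) • e x.2 := by
    unfold signedE; split <;> simp
  rw [h, mul_def]
  refine ext_components ?_ ?_ <;> ext <;>
    simp only [left_mk, right_mk, left_smul, right_smul, Quaternion.re_sub, Quaternion.imI_sub,
      Quaternion.imJ_sub, Quaternion.imK_sub, Quaternion.re_add, Quaternion.imI_add,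
      Quaternion.imJ_add, Quaternion.imK_add, Quaternion.re_mul, Quaternion.imI_mul,
      Quaternion.imJ_mul, Quaternion.imK_mul, Quaternion.re_smul, Quaternion.imI_smul,
      Quaternion.imJ_smul, Quaternion.imK_smul, Quaternion.re_star, Quaternion.imI_star,
      Quaternion.imJ_star, Quaternion.imK_star, left_e_re, left_e_imI, left_e_imJ, left_e_imK,
      right_e_re, right_e_imI, right_e_imJ, right_e_imK, smul_eq_mul] <;>
    -- All coordinates are `0` or `±1`, so each component is an integer identity over the 64 index
    -- pairs.
    norm_cast <;> revert i j <;> decide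

theorem neg_mul_eq (x y : Octonion) : -x * y = -(x * y) := by
  refine ext_components ?_ ?_ <;> simp [mul_def, left_mk, right_mk, left_neg, right_neg] <;> abel

theorem mul_neg_eq (x y : Octonion) : x * -y = -(x * y) := by
  refine ext_components ?_ ?_ <;> simp [mul_def, left_mk, right_mk, left_neg, right_neg] <;> abel

/-- Multiplication of signed basis indices. -/
def signedIndexMul (p q : Bool × Fin 8) : Bool × Fin 8 :=
  (xor (xor p.1 q.1) (signedMul p.2 q.2).1, (signedMul p.2 q.2).2)

/-- Negation of signed basis indices. -/
def signedIndexNeg (p : Bool × Fin 8) : Bool × Fin 8 := (!p.1, p.2)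

theorem signedE_mul (p q : Bool × Fin 8) :
    signedE p * signedE q = signedE (signedIndexMul p q) := by
  obtain ⟨s, i⟩ := p
  obtain ⟨t, j⟩ := q
  have h := e_mul i j
  cases s <;> cases t <;> cases hc : (signedMul i j).1 <;>
    simp_all [signedE, signedIndexMul, neg_mul_eq, mul_neg_eq]

theorem signedE_neg (p : Bool × Fin 8) : -signedE p = signedE (signedIndexNeg p) := by
  obtain ⟨s, i⟩ := p
  cases s <;> simp [signedE, signedIndexNeg]

theorem signedE_false (i : Fin 8) : signedE (false, i) = e i := rfl

theorem e_zero : e 0 = 1 := by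
  refine ext_components ?_ ?_ <;> ext <;>
    simp [left_one, right_one, left_e_re, left_e_imI, left_e_imJ, left_e_imK, right_e_re,
      right_e_imI, right_e_imJ, right_e_imK]

theorem signedE_true_zero : signedE (true, 0) = -1 := by
  simp [signedE, e_zero]

/-- A triple of basis indices, independent in the Fano plane, whose product is `± e j`. -/
def fanoTriple : Fin 7 → Fin 8 × Fin 8 × Fin 8 :=
  ![(2, 4, 7), (1, 4, 7), (1, 4, 6), (1, 2, 7), (1, 2, 6), (1, 2, 5), (1, 2, 4)]

/-- The product of the triple `fanoTriple j`. -/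
def fanoProduct (j : Fin 7) : Bool × Fin 8 :=
  signedIndexMul (signedMul (fanoTriple j).1 (fanoTriple j).2.1) (false, (fanoTriple j).2.2)

theorem fanoProduct_index : ∀ j : Fin 7, (fanoProduct j).2 = j.succ := by decide

end Octonion

namespace OctonionBimodule

open Octonion

theorem isQuaternionic_signedE {p q u : Bool × Fin 8}
    (h : signedIndexMul p p = (true, 0) ∧ signedIndexMul q q = (true, 0) ∧
      signedIndexMul u u = (true, 0) ∧ signedIndexMul q p = u ∧
      signedIndexMul p q = signedIndexNeg u ∧ signedIndexMul p u = q ∧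
      signedIndexMul u p = signedIndexNeg q ∧ signedIndexMul q u = signedIndexNeg p ∧
      signedIndexMul u q = p) :
    IsQuaternionic (signedE p) (signedE q) (signedE u) := by
  obtain ⟨h1, h2, h3, h4, h5, h6, h7, h8, h9⟩ := h
  constructor <;> simp only [signedE_mul, signedE_neg, ← signedE_true_zero, *]

theorem isOctonionic_fanoTriple (j : Fin 7) :
    IsOctonionic (e (fanoTriple j).1) (e (fanoTriple j).2.1) (e (fanoTriple j).2.2)
      (signedE (fanoProduct j)) := by
  constructor
  all_goals
    rw [e_mul, ← signedE_false]
    apply isQuaternionic_signedE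
    revert j
    decide

variable {V : Type*} [AddCommGroup V] [Module ℝ V] [OctonionBimodule V]

theorem conjOp_signedE (p : Bool × Fin 8) : conjOp V (signedE p) = conjOp V (e p.2) := by
  obtain ⟨s, i⟩ := p
  cases s <;> simp [signedE, conjOp]

/-- The point and the two further points on each of its three lines exhaust the seven imaginary
units, and `conjOp` does not see signs. -/
theorem sum_conjOp_fanoTriple (j : Fin 7) :
    conjOp V (signedE (fanoProduct j)) +
      (conjOp V (e (fanoTriple j).1) + conjOp V (e (fanoTriple j).2.1 * e (fanoTriple j).2.2)) +
      (conjOp V (e (fanoTriple j).2.1) + conjOp V (e (fanoTriple j).2.2 * e (fanoTriple j).1)) +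
      (conjOp V (e (fanoTriple j).2.2) + conjOp V (e (fanoTriple j).1 * e (fanoTriple j).2.1)) =
    ∑ i : Fin 7, conjOp V (e i.succ) := by
  simp only [e_mul, conjOp_signedE, Fin.sum_univ_seven, fanoProduct_index]
  fin_cases j <;> simp [fanoTriple, signedMul] <;> abel

variable (V) in
/-- The operator `Re` as an element of the ring of endomorphisms. -/
noncomputable def reOp : Module.End ℝ V :=
  (5 / 12 : ℝ) • 1 - (1 / 12 : ℝ) • ∑ i : Fin 7, conjOp V (e i.succ)

theorem reOp_apply (x : V) : reOp V x = re x := by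
  simp [reOp, re, conjOp, rop, lop]

end OctonionBimodule

namespace Octonion

theorem exists_eq_sum_e (p : Octonion) : ∃ c : Fin 8 → ℝ, p = ∑ i, c i • e i := by
  refine ⟨![p.left.re, p.left.imI, p.left.imJ, p.left.imK, p.right.re, p.right.imI, p.right.imJ,
    p.right.imK], ?_⟩
  rw [Fin.sum_univ_eight]
  refine ext_components ?_ ?_ <;> ext <;>
    simp [left_add, right_add, left_smul, right_smul, left_e_re, left_e_imI, left_e_imJ,
      left_e_imK, right_e_re, right_e_imI, right_e_imJ, right_e_imK]

end Octonion

/-! ### The projection `Re`: commutators, associators and nondegeneracy -/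

namespace OctonionBimodule

open Octonion

theorem five_eq_smul_one {V : Type*} [AddCommGroup V] [Module ℝ V] : (5 : Module.End ℝ V) = (5 : ℝ) • 1 := by
  ext
  simp [Module.End.ofNat_apply, ofNat_smul_eq_nsmul]

variable {V : Type*} [AddCommGroup V] [Module ℝ V] [OctonionBimodule V]

theorem lop_e_sub_rop_e_mul_reOp (j : Fin 7) :
    (lop V (e j.succ) - rop V (e j.succ)) * reOp V = 0 := by
  have h := (isOctonionic_fanoTriple j).lop_sub_rop_mul_sum V
  rw [sum_conjOp_fanoTriple] at h
  have h' : (lop V (e j.succ) - rop V (e j.succ)) * ∑ i : Fin 7, conjOp V (e i.succ) =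
      (5 : ℝ) • (lop V (e j.succ) - rop V (e j.succ)) := by
    rw [five_eq_smul_one, smul_mul_assoc, one_mul] at h
    unfold signedE at h
    rw [fanoProduct_index] at h
    -- The product of the triple is `e j.succ` only up to sign; the identity is odd in it, so the
    -- sign is harmless.
    split at h
    · rw [map_neg, map_neg] at h
      linear_combination (norm := (simp only [sub_mul, neg_mul, smul_sub, smul_neg]; abel)) -h
    · exact h
  rw [reOp, mul_sub, mul_smul_comm, mul_smul_comm, h', mul_one]
  module

theorem reOp_mul_lop_e_sub_rop_e (j : Fin 7) :
    reOp V * (lop V (e j.succ) - rop V (e j.succ)) = 0 := by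
  have h := (isOctonionic_fanoTriple j).sum_mul_lop_sub_rop V
  rw [sum_conjOp_fanoTriple] at h
  have h' : (∑ i : Fin 7, conjOp V (e i.succ)) * (lop V (e j.succ) - rop V (e j.succ)) =
      (5 : ℝ) • (lop V (e j.succ) - rop V (e j.succ)) := by
    rw [five_eq_smul_one, smul_mul_assoc, one_mul] at h
    unfold signedE at h
    rw [fanoProduct_index] at h
    split at h
    · rw [map_neg, map_neg] at h
      linear_combination (norm := (simp only [mul_sub, mul_neg, smul_sub, smul_neg]; abel)) -h
    · exact h
  rw [reOp, sub_mul, smul_mul_assoc, smul_mul_assoc, h', one_mul]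
  module

theorem lop_mul_reOp (p : Octonion) : lop V p * reOp V = rop V p * reOp V := by
  obtain ⟨c, rfl⟩ := p.exists_eq_sum_e
  rw [map_sum, map_sum, Finset.sum_mul, Finset.sum_mul]
  refine Finset.sum_congr rfl fun i _ => ?_
  rw [map_smul, map_smul, smul_mul_assoc, smul_mul_assoc]
  congr 1
  induction i using Fin.cases with
  | zero => rw [e_zero, lop_one, rop_one]
  | succ j => rw [← sub_eq_zero, ← sub_mul, lop_e_sub_rop_e_mul_reOp]

theorem reOp_mul_lop (p : Octonion) : reOp V * lop V p = reOp V * rop V p := by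
  obtain ⟨c, rfl⟩ := p.exists_eq_sum_e
  rw [map_sum, map_sum, Finset.mul_sum, Finset.mul_sum]
  refine Finset.sum_congr rfl fun i _ => ?_
  rw [map_smul, map_smul, mul_smul_comm, mul_smul_comm]
  congr 1
  induction i using Fin.cases with
  | zero => rw [e_zero, lop_one, rop_one]
  | succ j => rw [← sub_eq_zero, ← mul_sub, reOp_mul_lop_e_sub_rop_e]

/-- Once left and right multiplication agree on the range of `Re`, the left, middle and right forms
of the associator add up to zero, so three times the associator vanishes there. The dual statement
follows in the same way. -/
theorem assocOp_mul_reOp (p q : Octonion) : assocOp V p q * reOp V = 0 := by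
  have h1 := congrArg (· * reOp V) (assocOp_left (V := V) p q)
  have h2 := congrArg (· * reOp V) (assocOp_middle (V := V) q p)
  have h3 := congrArg (· * reOp V) (assocOp_right (V := V) p q)
  rw [assocOp_swap] at h2
  simp only [sub_mul, neg_mul, mul_assoc, ← lop_mul_reOp] at h1 h2 h3
  linear_combination (norm := module) (1 / 3 : ℝ) • (h1 - h2 + h3)

theorem reOp_mul_assocOp (p q : Octonion) : reOp V * assocOp V p q = 0 := by
  have h1 := congrArg (reOp V * ·) (assocOp_left (V := V) p q)
  have h2 := congrArg (reOp V * ·) (assocOp_middle (V := V) p q)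
  have h3 := congrArg (reOp V * ·) (assocOp_right (V := V) p q)
  simp only [mul_sub, ← mul_assoc, ← reOp_mul_lop] at h1 h2 h3
  linear_combination (norm := module) (1 / 3 : ℝ) • (h1 + h2 + h3)

theorem re_mem_realPart (x : V) : re x ∈ realPart V := by
  rw [← reOp_apply]
  exact ⟨fun p q => LinearMap.congr_fun (assocOp_mul_reOp (V := V) p q) x,
    fun p => sub_eq_zero.2 (LinearMap.congr_fun (lop_mul_reOp (V := V) p) x)⟩

theorem rmul_rmul_of_mem_realPart {v : V} (hv : v ∈ realPart V) (p q : Octonion) :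
    rmul q (rmul p v) = rmul (p * q) v := by
  rw [← sub_eq_zero, ← middle_assoc_eq_right, ← left_assoc_eq_middle, hv.1]

theorem e_succ_mul_self (i : Fin 7) : e i.succ * e i.succ = -1 := by
  rw [e_mul, ← signedE_true_zero]
  congr 1
  revert i
  decide

/-- Each `e_i v e_i` equals `-v`, and `5 / 12 + 7 / 12 = 1`. -/
theorem re_eq_self_of_mem_realPart {v : V} (hv : v ∈ realPart V) : re v = v := by
  have h (i : Fin 7) : rmul (e i.succ) (lmul (e i.succ) v) = -v := by
    rw [sub_eq_zero.1 (hv.2 _), rmul_rmul_of_mem_realPart hv, e_succ_mul_self, map_neg,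
      LinearMap.neg_apply, rmul_one]
  simp only [re, h, Finset.sum_const, Finset.card_univ, Fintype.card_fin]
  module

theorem re_rmul_rmul (p q : Octonion) (x : V) : re (rmul q (rmul p x)) = re (rmul (p * q) x) := by
  have h := LinearMap.congr_fun (reOp_mul_assocOp (V := V) p q) x
  rw [assocOp_right, mul_sub, LinearMap.sub_apply, LinearMap.zero_apply, sub_eq_zero] at h
  simp only [← reOp_apply]
  exact h

/-- Let `C` be the sum of the seven conjugations. On the kernel of `Re`, `C` acts as `5`; this
applies to `x` and to each `x e_j`. Then `rop_mul_sum_mul_rop` reads `-5 x = 5 x - 6 (e_j x e_j) - 4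
x`, so every conjugation fixes `x`. Hence `C x = 7 x`, while `C x = 5 x`. -/
theorem eq_zero_of_re_rmul_eq_zero {x : V} (hx : ∀ q : Octonion, re (rmul q x) = 0) : x = 0 := by
  have h5 {y : V} (hy : re y = 0) : (∑ i : Fin 7, conjOp V (e i.succ)) y = (5 : ℝ) • y := by
    rw [← reOp_apply, reOp, LinearMap.sub_apply, LinearMap.smul_apply, LinearMap.smul_apply,
      Module.End.one_apply] at hy
    linear_combination (norm := module) (-12 : ℝ) • hy
  have hx0 : re x = 0 := by simpa only [rmul_one] using hx 1
  have hj (j : Fin 7) : conjOp V (e j.succ) x = x := by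
    have hO := isOctonionic_fanoTriple j
    have h := LinearMap.congr_fun (hO.rop_mul_sum_mul_rop V) x
    have hr := LinearMap.congr_fun (rop_mul_self (V := V) hO.hx.uu) x
    rw [sum_conjOp_fanoTriple, conjOp_signedE, fanoProduct_index] at h
    simp only [Module.End.mul_apply, LinearMap.sub_apply, LinearMap.neg_apply,
      Module.End.one_apply, LinearMap.smul_apply, Module.End.ofNat_apply] at h hr
    rw [h5 hx0, h5 (y := rop V _ x) (hx _), map_smul, hr] at h
    linear_combination (norm := module) (1 / 6 : ℝ) • h
  have h := h5 hx0
  rw [LinearMap.sum_apply, Finset.sum_congr rfl fun j _ => hj j, Finset.sum_const,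
    Finset.card_univ, Fintype.card_fin] at h
  linear_combination (norm := module) (1 / 2 : ℝ) • h

end OctonionBimodule

/-! ### The slices `ℂ_J` as isometric copies of `ℂ` -/

namespace Octonion

theorem norm_sq_eq (x : Octonion) : ‖x‖ ^ 2 =
    x.left.re ^ 2 + x.left.imI ^ 2 + x.left.imJ ^ 2 + x.left.imK ^ 2 +
      (x.right.re ^ 2 + x.right.imI ^ 2 + x.right.imJ ^ 2 + x.right.imK ^ 2) := by
  have h : ‖x‖ ^ 2 = ‖x.left‖ ^ 2 + ‖x.right‖ ^ 2 := WithLp.prod_norm_sq_eq_of_L2 x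
  rw [h, sq ‖x.left‖, sq ‖x.right‖, ← Quaternion.normSq_eq_norm_mul_self,
    ← Quaternion.normSq_eq_norm_mul_self, Quaternion.normSq_def', Quaternion.normSq_def']

theorem re_eq_zero_and_norm_of_mem_imaginaryUnits {J : Octonion} (hJ : J ∈ imaginaryUnits) :
    J.left.re = 0 ∧ ‖J‖ ^ 2 = 1 := by
  have hJ' : J * J = -1 := hJ
  have hl := congrArg left hJ'
  have hr := congrArg right hJ'
  rw [mul_def, left_mk, left_neg, left_one] at hl
  rw [mul_def, right_mk, right_neg, right_one] at hr
  have l0 := congrArg QuaternionAlgebra.re hl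
  have l1 := congrArg QuaternionAlgebra.imI hl
  have l2 := congrArg QuaternionAlgebra.imJ hl
  have l3 := congrArg QuaternionAlgebra.imK hl
  have r0 := congrArg QuaternionAlgebra.re hr
  have r1 := congrArg QuaternionAlgebra.imI hr
  have r2 := congrArg QuaternionAlgebra.imJ hr
  have r3 := congrArg QuaternionAlgebra.imK hr
  simp at l0 l1 l2 l3 r0 r1 r2 r3
  rw [norm_sq_eq]
  generalize J.left.re = a0 at *
  generalize J.left.imI = a1 at *
  generalize J.left.imJ = a2 at *
  generalize J.left.imK = a3 at *
  generalize J.right.re = b0 at *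
  generalize J.right.imI = b1 at *
  generalize J.right.imJ = b2 at *
  generalize J.right.imK = b3 at *
  -- A nonzero real part would force all imaginary coordinates to vanish, leaving `a0 ^ 2 = -1`.
  have ha : a0 = 0 := by
    by_contra h
    have z1 : a1 = 0 := (mul_eq_zero.1 (by linarith : a0 * a1 = 0)).resolve_left h
    have z2 : a2 = 0 := (mul_eq_zero.1 (by linarith : a0 * a2 = 0)).resolve_left h
    have z3 : a3 = 0 := (mul_eq_zero.1 (by linarith : a0 * a3 = 0)).resolve_left h
    have y0 : b0 = 0 := r0.resolve_right h
    have y1 : b1 = 0 := (mul_eq_zero.1 (by linarith : a0 * b1 = 0)).resolve_left h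
    have y2 : b2 = 0 := (mul_eq_zero.1 (by linarith : a0 * b2 = 0)).resolve_left h
    have y3 : b3 = 0 := (mul_eq_zero.1 (by linarith : a0 * b3 = 0)).resolve_left h
    subst z1 z2 z3 y0 y1 y2 y3
    nlinarith [mul_self_nonneg a0]
  subst ha
  exact ⟨rfl, by linarith⟩

/-- The parametrization of the slice `ℂ_J` by the complex numbers. -/
noncomputable def sliceMap (J : Octonion) (z : ℂ) : Octonion := z.re • (1 : Octonion) + z.im • J

theorem continuous_sliceMap (J : Octonion) : Continuous (sliceMap J) :=
  (Complex.continuous_re.smul continuous_const).add (Complex.continuous_im.smul continuous_const)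

theorem sliceMap_mem_slice (J : Octonion) (z : ℂ) : sliceMap J z ∈ slice J := ⟨z.re, z.im, rfl⟩

theorem exists_sliceMap_eq {J s : Octonion} (hs : s ∈ slice J) : ∃ z, sliceMap J z = s := by
  obtain ⟨a, b, rfl⟩ := hs
  exact ⟨⟨a, b⟩, rfl⟩

theorem norm_sliceMap {J : Octonion} (hJ : J ∈ imaginaryUnits) (z : ℂ) :
    ‖sliceMap J z‖ = ‖z‖ := by
  obtain ⟨h0, h1⟩ := re_eq_zero_and_norm_of_mem_imaginaryUnits hJ
  rw [norm_sq_eq, h0] at h1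
  rw [← sq_eq_sq₀ (norm_nonneg _) (norm_nonneg _), norm_sq_eq, Complex.sq_norm,
    Complex.normSq_apply]
  simp only [sliceMap, left_add, right_add, left_smul, right_smul, left_one, right_one,
    Quaternion.re_add, Quaternion.imI_add, Quaternion.imJ_add, Quaternion.imK_add,
    Quaternion.re_smul, Quaternion.imI_smul, Quaternion.imJ_smul, Quaternion.imK_smul,
    Quaternion.re_one, Quaternion.imI_one, Quaternion.imJ_one, Quaternion.imK_one,
    Quaternion.re_zero, Quaternion.imI_zero, Quaternion.imJ_zero, Quaternion.imK_zero, h0,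
    smul_eq_mul]
  linear_combination z.im ^ 2 * h1

theorem smul_mul_smul_eq (c d : ℝ) (x y : Octonion) : (c • x) * (d • y) = (c * d) • (x * y) := by
  have hs (x : ℍ[ℝ]) : star (d • x) = d • star x := by
    ext <;> simp
  refine ext_components ?_ ?_ <;>
    simp only [mul_def, left_mk, right_mk, left_smul, right_smul, hs, smul_mul_smul_comm,
      smul_sub, smul_add, mul_comm d c]

theorem mul_self_of_re_eq_zero {m : Octonion} (hm : m.left.re = 0) :
    m * m = (-‖m‖ ^ 2) • (1 : Octonion) := by
  rw [norm_sq_eq]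
  refine ext_components ?_ ?_ <;> ext <;>
    simp [mul_def, left_mk, right_mk, left_smul, right_smul, left_one, right_one, hm] <;> ring

theorem exists_mem_slice (s : Octonion) : ∃ J ∈ imaginaryUnits, s ∈ slice J := by
  set m : Octonion := s - s.left.re • (1 : Octonion) with hm
  have hsm : s = s.left.re • (1 : Octonion) + m := by rw [hm]; abel
  have hm0 : m.left.re = 0 := by
    have := congrArg (fun x : Octonion => x.left.re) hsm
    simpa [left_add, left_smul, left_one] using this
  rcases eq_or_ne m 0 with h | h
  -- A real `s` lies in every slice; `e 1` is an arbitrary choice.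
  · refine ⟨e 1, ?_, s.left.re, 0, ?_⟩
    · exact (e_mul 1 1).trans signedE_true_zero
    · rw [zero_smul, ← h]; exact hsm
  · have hn : ‖m‖ ≠ 0 := norm_ne_zero_iff.2 h
    refine ⟨‖m‖⁻¹ • m, ?_, s.left.re, ‖m‖, ?_⟩
    · change _ * _ = _
      rw [smul_mul_smul_eq, mul_self_of_re_eq_zero hm0, smul_smul]
      have : ‖m‖⁻¹ * ‖m‖⁻¹ * -‖m‖ ^ 2 = -1 := by field_simp
      rw [this, neg_one_smul]
    · rw [smul_smul, mul_inv_cancel₀ hn, one_smul]; exact hsm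

end Octonion

/-! ### Translation of the slice spectra into the Banach algebra setting -/

namespace OctonionBimodule

open Octonion MulOpposite

variable {V : Type*} [NormedAddCommGroup V] [NormedSpace ℝ V] [NormedOctonionBimodule V]

theorem R_apply (s : Octonion) (x : V) : R V s x = rmul s x := rfl

theorem norm_R [Nontrivial V] (s : Octonion) : ‖R V s‖ = ‖s‖ :=
  ContinuousLinearMap.homothety_norm _ (NormedOctonionBimodule.norm_rmul s)

variable (V) in
/-- The real part operator as a bounded operator. -/
noncomputable def reCLM : V →L[ℝ] V :=
  LinearMap.mkContinuous (reOp V) (5 / 12 + 1 / 12 * ∑ i : Fin 7, ‖e i.succ‖ * ‖e i.succ‖)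
    fun x => by
      rw [reOp_apply, re]
      refine (norm_sub_le _ _).trans ?_
      rw [norm_smul, norm_smul, add_mul, mul_assoc, Finset.sum_mul]
      norm_num
      refine (norm_sum_le _ _).trans (Finset.sum_le_sum fun i _ => ?_)
      rw [NormedOctonionBimodule.norm_rmul, NormedOctonionBimodule.norm_lmul, mul_assoc]

theorem reCLM_apply (x : V) : reCLM V x = re x := reOp_apply x

theorem reCLM_ne_zero [Nontrivial V] : reCLM V ≠ 0 := by
  intro h
  obtain ⟨x, hx⟩ := exists_ne (0 : V)
  exact hx (eq_zero_of_re_rmul_eq_zero fun q => by rw [← reCLM_apply, h]; rfl)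

variable (V) in
/-- Right multiplication by the slice `ℂ_J` as a representation of the complex numbers. -/
noncomputable def sliceRep {J : Octonion} (hJ : J ∈ imaginaryUnits) : ℂ →ₐ[ℝ] (V →L[ℝ] V) :=
  Complex.lift ⟨R V J, ContinuousLinearMap.ext fun x =>
    LinearMap.congr_fun (rop_mul_self (V := V) hJ) x⟩

theorem sliceRep_apply {J : Octonion} (hJ : J ∈ imaginaryUnits) (z : ℂ) :
    sliceRep V hJ z = R V (sliceMap J z) := by
  ext x
  simp [sliceRep, sliceMap, R_apply, Complex.liftAux_apply, Algebra.algebraMap_eq_smul_one,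
    OctonionBimodule.rmul_one]

theorem norm_sliceRep [Nontrivial V] {J : Octonion} (hJ : J ∈ imaginaryUnits) (z : ℂ) :
    ‖sliceRep V hJ z‖ = ‖z‖ := by
  rw [sliceRep_apply, norm_R, norm_sliceMap hJ]

variable (V) in
/-- The representation `sliceRep` with values in the opposite algebra. -/
noncomputable def sliceRepOp {J : Octonion} (hJ : J ∈ imaginaryUnits) :
    ℂ →ₐ[ℝ] (V →L[ℝ] V)ᵐᵒᵖ :=
  (sliceRep V hJ).toOpposite fun x y => by
    rw [commute_iff_eq, ← map_mul, mul_comm, map_mul]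

theorem sliceRepOp_apply {J : Octonion} (hJ : J ∈ imaginaryUnits) (z : ℂ) :
    sliceRepOp V hJ z = op (sliceRep V hJ z) := rfl

theorem norm_sliceRepOp [Nontrivial V] {J : Octonion} (hJ : J ∈ imaginaryUnits) (z : ℂ) :
    ‖sliceRepOp V hJ z‖ = ‖z‖ := norm_sliceRep hJ z

/-- The difference of the two sides is tested by `Re (· q)`. Para-linearity moves `q` and `p` inside
`T`; since `Re` kills associators and `v` associates, both sides become `Re (T (v (p q)))`. -/
theorem IsParaLinear.map_rmul {T : V →L[ℝ] V} (hT : IsParaLinear T) {v : V}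
    (hv : v ∈ realPart V) (p : Octonion) : T (rmul p v) = rmul p (T v) := by
  have h (q : Octonion) (x : V) : re (rmul q (T x)) = re (T (rmul q x)) := by
    have := hT q x
    rwa [← reOp_apply, map_sub, sub_eq_zero, reOp_apply, reOp_apply] at this
  rw [← sub_eq_zero]
  refine eq_zero_of_re_rmul_eq_zero fun q => ?_
  rw [map_sub, ← reOp_apply, map_sub, sub_eq_zero, reOp_apply, reOp_apply, h, re_rmul_rmul, h,
    rmul_rmul_of_mem_realPart hv]

/-- The range of `Re` is `Re V`, so evaluating on `Re V` amounts to composing with `Re` on the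
right. The exponent `0`, absent from the left side, is trivial. -/
theorem isExtendable_iff {J : Octonion} (hJ : J ∈ imaginaryUnits) (S : V →L[ℝ] V) :
    IsExtendablePowerAssociative J S ↔ reCLM V ∈ commutingSubmodule (sliceRep V hJ) S := by
  constructor
  · intro h n w
    rcases Nat.eq_zero_or_pos n with rfl | hn
    · simp
    · ext x
      rw [sliceRep_apply]
      simpa [R_apply, reCLM_apply] using
        h n hn _ (re_mem_realPart x) _ (sliceMap_mem_slice J w)
  · intro h n _ v hv s hs
    obtain ⟨z, rfl⟩ := exists_sliceMap_eq hs
    have := DFunLike.congr_fun (h n z) v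
    rw [sliceRep_apply] at this
    simpa [R_apply, reCLM_apply, re_eq_self_of_mem_realPart hv] using this

/-- Here `Re` is applied last, so it becomes the rightmost factor after passing to the opposite
algebra. -/
theorem isLiftable_iff {J : Octonion} (hJ : J ∈ imaginaryUnits) (S : V →L[ℝ] V) :
    IsLiftablePowerAssociative J S ↔
      op (reCLM V) ∈ commutingSubmodule (sliceRepOp V hJ) (op S) := by
  have key (n : ℕ) (w : ℂ) : op S ^ n * (sliceRepOp V hJ w * op (reCLM V)) =
      sliceRepOp V hJ w * (op S ^ n * op (reCLM V)) ↔
      ∀ v : V, re (rmul (sliceMap J w) ((S ^ n) v)) = re ((S ^ n) (rmul (sliceMap J w) v)) := by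
    rw [sliceRepOp_apply, ← op_pow, ← op_mul, ← op_mul, ← op_mul, ← op_mul, op_inj,
      sliceRep_apply, ContinuousLinearMap.ext_iff]
    simp [R_apply, reCLM_apply]
  constructor
  · intro h n w
    rw [key]
    intro v
    rcases Nat.eq_zero_or_pos n with rfl | hn
    · simp
    · exact (h n hn v _ (sliceMap_mem_slice J w)).symm
  · intro h n _ v s hs
    obtain ⟨z, rfl⟩ := exists_sliceMap_eq hs
    exact ((key n z).1 (h n z) v).symm

theorem sliceMap_mem_pullback_iff {J : Octonion} (hJ : J ∈ imaginaryUnits) (T : V →L[ℝ] V)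
    (z : ℂ) : sliceMap J z ∈ pullbackSliceResolventSet T J ↔
      z ∈ sliceResolvent (sliceRep V hJ) T (reCLM V) := by
  simp [pullbackSliceResolventSet, sliceResolvent, sliceMap_mem_slice, isExtendable_iff hJ,
    sliceRep_apply]

theorem sliceMap_mem_pushforward_iff {J : Octonion} (hJ : J ∈ imaginaryUnits) (T : V →L[ℝ] V)
    (z : ℂ) : sliceMap J z ∈ pushforwardSliceResolventSet T J ↔
      z ∈ sliceResolvent (sliceRepOp V hJ) (op T) (op (reCLM V)) := by
  simp only [pushforwardSliceResolventSet, sliceResolvent, sliceMap_mem_slice, isLiftable_iff hJ,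
    sliceRepOp_apply, sliceRep_apply, Set.mem_ofPred_eq, true_and, op_surjective.exists, ← op_sub,
    ← op_mul, op_eq_one_iff]
  -- Passing to the opposite algebra exchanges the left-inverse and right-inverse equations.
  exact exists_congr fun S => and_left_comm

theorem slice_diff_eq_image {J : Octonion} {U : Set Octonion} {U' : Set ℂ}
    (h : ∀ z, sliceMap J z ∈ U ↔ z ∈ U') : slice J \ U = sliceMap J '' U'ᶜ := by
  ext s
  constructor
  · rintro ⟨hs, hsU⟩
    obtain ⟨z, rfl⟩ := exists_sliceMap_eq hs
    exact ⟨z, fun hz => hsU ((h z).2 hz), rfl⟩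
  · rintro ⟨z, hz, rfl⟩
    exact ⟨sliceMap_mem_slice J z, fun hs => hz ((h z).1 hs)⟩

theorem IsPowerAssociative.reCLM_mem {T : V →L[ℝ] V} (hT : IsPowerAssociative T) {J : Octonion}
    (hJ : J ∈ imaginaryUnits) : reCLM V ∈ commutingSubmodule (sliceRep V hJ) T :=
  (isExtendable_iff hJ T).1 fun n _ _ hv s _ => (hT.2 n).map_rmul hv s

theorem IsPowerAssociative.op_reCLM_mem {T : V →L[ℝ] V} (hT : IsPowerAssociative T) {J : Octonion}
    (hJ : J ∈ imaginaryUnits) : op (reCLM V) ∈ commutingSubmodule (sliceRepOp V hJ) (op T) :=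
  (isLiftable_iff hJ T).1 fun n _ v s _ => by
    have h := hT.2 n s v
    rw [← reOp_apply, map_sub, sub_eq_zero, reOp_apply, reOp_apply] at h
    exact h.symm

end OctonionBimodule

open Octonion OctonionBimodule MulOpposite in
theorem mainTheorem8 {V : Type*} [NormedAddCommGroup V] [NormedSpace ℝ V] [CompleteSpace V]
    [Nontrivial V] [NormedOctonionBimodule V] (T : V →L[ℝ] V)
    (hT : OctonionBimodule.IsPowerAssociative T) :
    (∀ s : Octonion, ‖T‖ < ‖s‖ →
      s ∈ OctonionBimodule.pullbackResolventSet T ∧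
      s ∈ OctonionBimodule.pushforwardResolventSet T) ∧
    ∀ J ∈ Octonion.imaginaryUnits,
      (OctonionBimodule.pullbackSliceSpectrum T J ⊆ Octonion.slice J ∧
        IsCompact (OctonionBimodule.pullbackSliceSpectrum T J) ∧
        (OctonionBimodule.pullbackSliceSpectrum T J).Nonempty) ∧
      (OctonionBimodule.pushforwardSliceSpectrum T J ⊆ Octonion.slice J ∧
        IsCompact (OctonionBimodule.pushforwardSliceSpectrum T J) ∧
        (OctonionBimodule.pushforwardSliceSpectrum T J).Nonempty) := by
  constructor
  · intro s hs
    obtain ⟨J, hJ, hsJ⟩ := exists_mem_slice s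
    obtain ⟨z, rfl⟩ := exists_sliceMap_eq hsJ
    rw [norm_sliceMap hJ] at hs
    exact ⟨Set.mem_biUnion hJ ((sliceMap_mem_pullback_iff hJ T z).2
        (mem_sliceResolvent_of_norm_lt _ (norm_sliceRep hJ) (hT.reCLM_mem hJ) hs)),
      Set.mem_biUnion hJ ((sliceMap_mem_pushforward_iff hJ T z).2
        (mem_sliceResolvent_of_norm_lt (sliceRepOp V hJ) (norm_sliceRepOp hJ)
          (hT.op_reCLM_mem hJ) hs))⟩
  · intro J hJ
    refine ⟨⟨Set.sdiff_subset, ?_⟩, ⟨Set.sdiff_subset, ?_⟩⟩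
    · rw [pullbackSliceSpectrum, slice_diff_eq_image (sliceMap_mem_pullback_iff hJ T)]
      exact ⟨(isCompact_compl_sliceResolvent _ (norm_sliceRep hJ) (hT.reCLM_mem hJ)).image
          (continuous_sliceMap J),
        (Set.nonempty_compl.2 (sliceResolvent_ne_univ _ (norm_sliceRep hJ)
          reCLM_ne_zero)).image _⟩
    · rw [pushforwardSliceSpectrum, slice_diff_eq_image (sliceMap_mem_pushforward_iff hJ T)]
      exact ⟨(isCompact_compl_sliceResolvent (sliceRepOp V hJ) (norm_sliceRepOp hJ)
          (hT.op_reCLM_mem hJ)).image (continuous_sliceMap J),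
        (Set.nonempty_compl.2 (sliceResolvent_ne_univ (sliceRepOp V hJ) (norm_sliceRepOp hJ)
          ((op_ne_zero_iff _).2 reCLM_ne_zero))).image _⟩
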